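/- All rings are associative with identity, not necessarily commutative. For a ring $S$, let $\mathrm{nil}(S)$ be its set of nilpotent elements; $S$ is reduced if $\mathrm{nil}(S)=\{0\}$, and $2$-primal if $\mathrm{nil}(S)$ equals the prime radical of $S$ (the intersection of all its prime two-sided ideals). Let $Z_N^*(S)$ be the set of non-zero $a\in S$ such that $ab\in\mathrm{nil}(S)$ for some non-zero $b\in S$. The nilpotent graph $\Gamma_N(S)$ has vertex set $Z_N^*(S)$, and two distinct vertices $a,b$ are adjacent if and only if $ab\in\mathrm{nil}(S)$. The girth $gr(\Gamma)$ of a graph $\Gamma$ is the length of a shortest cycle, and $gr(\Gamma)=\infty$ if $\Gamma$ has no cycle. Let $n\ge 1$. A ring $A$ is a skew PBW extension $\sigma(R)\langle x_1,\dots,x_n\rangle$ of a subring $R$ (with the same identity) in the elements $x_1,\dots,x_n\in A$ if: the standard monomials $x^\alpha=x_1^{\alpha_1}\cdots x_n^{\alpha_n}$, $\alpha\in\mathbb N^n$, form a basis of $A$ as a left $R$-module; for all $i$ and all non-zero $r\in R$ there is a non-zero $c_{i,r}\in R$ with $x_ir-c_{i,r}x_i\in R$; and for all $1\le i,j\le n$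 there is a non-zero $d_{i,j}\in R$ with $x_jx_i-d_{i,j}x_ix_j\in R+Rx_1+\cdots+Rx_n$. Then $x_ir=\sigma_i(r)x_i+\delta_i(r)$ for all $r\in R$, with uniquely determined maps $\sigma_i,\delta_i:R\to R$, where $\sigma_i$ is an injective ring endomorphism and $\delta_i$ a $\sigma_i$-derivation. Put $\sigma^\alpha=\sigma_1^{\alpha_1}\circ\cdots\circ\sigma_n^{\alpha_n}$ and $\delta^\beta=\delta_1^{\beta_1}\circ\cdots\circ\delta_n^{\beta_n}$ for $\alpha,\beta\in\mathbb N^n$. The ring $R$ is $(\Sigma,\Delta)$-compatible if for all $a,b\in R$ and $\alpha,\beta\in\mathbb N^n$: $a\sigma^\alpha(b)=0$ if and only if $ab=0$; and $ab=0$ implies $a\delta^\beta(b)=0$. **Theorem.** Let $n\ge 1$ and let $A=\sigma(R)\langle x_1,\dots,x_n\rangle$ be a skew PBW extension of $R$. If $R$ is $(\Sigma,\Delta)$-compatible and $2$-primal, $gr(\Gamma_N(R))=\infty$ and $Z_N^*(R)\neq\emptyset$, then either $|\mathrm{nil}(R)|=2$ and $gr(\Gamma_N(A))=3$, or $R$ is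 reduced and $gr(\Gamma_N(A))=4$. -/

import Mathlib

/-! ### 2-primal rings and the nilpotent graph -/

/-- A two-sided ideal `P` of a (not necessarily commutative) ring is prime if it is proper and
`I J ⊆ P` implies `I ⊆ P` or `J ⊆ P` for all two-sided ideals `I`, `J`. -/
def TwoSidedIdeal.IsPrimeIdeal {S : Type*} [Ring S] (P : TwoSidedIdeal S) : Prop :=
  P ≠ ⊤ ∧ ∀ I J : TwoSidedIdeal S, (∀ a ∈ I, ∀ b ∈ J, a * b ∈ P) → I ≤ P ∨ J ≤ P

/-- The prime radical: the intersection of all prime two-sided ideals. -/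
def primeRadical (S : Type*) [Ring S] : TwoSidedIdeal S :=
  sInf {P : TwoSidedIdeal S | P.IsPrimeIdeal}

/-- The set `nil(S)` of nilpotent elements. -/
def nilSet (S : Type*) [Ring S] : Set S := {a | IsNilpotent a}

/-- `S` is 2-primal if its prime radical equals its set of nilpotent elements. -/
def IsTwoPrimal (S : Type*) [Ring S] : Prop :=
  (primeRadical S : Set S) = nilSet S

/-- `Z_N^*(S)`: the non-zero elements `a` such that `a * b` is nilpotent for some non-zero `b`. -/
def nilZeroDivisors (S : Type*) [Ring S] : Set S :=
  {a | a ≠ 0 ∧ ∃ b : S, b ≠ 0 ∧ a * b ∈ nilSet S}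

theorem mul_mem_nilSet_symm {S : Type*} [Ring S] {a b : S} (h : a * b ∈ nilSet S) :
    b * a ∈ nilSet S := by
  obtain ⟨k, hk⟩ := h
  refine ⟨k + 1, ?_⟩
  have key : ∀ m : ℕ, (b * a) ^ (m + 1) = b * (a * b) ^ m * a := by
    intro m
    induction m with
    | zero => simp
    | succ m ih => rw [pow_succ, ih, pow_succ (a * b)]; simp only [mul_assoc]
  rw [key, hk]
  simp

/-- The nilpotent graph `Γ_N(S)`: vertex set `Z_N^*(S)`, and two distinct vertices `a`, `b` are
adjacent if and only if `a * b` is nilpotent. -/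
def nilpotentGraph (S : Type*) [Ring S] : SimpleGraph (nilZeroDivisors S) where
  Adj a b := a ≠ b ∧ (a : S) * (b : S) ∈ nilSet S
  symm := ⟨fun _ _ h => ⟨h.1.symm, mul_mem_nilSet_symm h.2⟩⟩
  loopless := ⟨fun _ h => h.1 rfl⟩

/-! ### Skew PBW extensions -/

/-- The standard monomial `x^α = x_1^{α_1} ⋯ x_n^{α_n}` (factors in this order). -/
def stdMonomial {A : Type*} [Ring A] {n : ℕ} (x : Fin n → A) (α : Fin n → ℕ) : A :=
  (List.ofFn fun i => x i ^ α i).prod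

/-- `A` is a skew PBW extension `σ(R)⟨x_1, …, x_n⟩` of its subring `R` in the elements
`x_1, …, x_n`. -/
structure IsSkewPBWExtension {A : Type*} [Ring A] (R : Subring A) {n : ℕ} (x : Fin n → A) :
    Prop where
  linearIndependent : LinearIndependent R (stdMonomial x)
  span_eq_top : Submodule.span R (Set.range (stdMonomial x)) = ⊤
  exists_coeff : ∀ (i : Fin n) (r : R), r ≠ 0 →
    ∃ c : R, c ≠ 0 ∧ x i * (r : A) - (c : A) * x i ∈ R
  exists_comm : ∀ i j : Fin n, ∃ d : R, d ≠ 0 ∧ ∃ (r₀ : R) (r : Fin n → R),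
    x j * x i - (d : A) * (x i * x j) = (r₀ : A) + ∑ k, (r k : A) * x k

theorem stdMonomial_zero {A : Type*} [Ring A] {n : ℕ} (x : Fin n → A) :
    stdMonomial x 0 = 1 := by
  simp [stdMonomial]

theorem stdMonomial_single {A : Type*} [Ring A] {n : ℕ} (x : Fin n → A) (i : Fin n) :
    stdMonomial x (Pi.single i 1) = x i := by
  induction n with
  | zero => exact i.elim0
  | succ n ih =>
    unfold stdMonomial at ih ⊢
    rw [List.ofFn_succ, List.prod_cons]
    refine Fin.cases ?_ (fun j => ?_) i
    · simp
    · have h := ih (fun k => x k.succ) j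
      have e : (fun k : Fin n => x k.succ ^ (Pi.single j.succ 1 : Fin (n + 1) → ℕ) k.succ)
          = fun k => x k.succ ^ (Pi.single j 1 : Fin n → ℕ) k := by
        funext k
        simp [Pi.single_apply]
      rw [e, h]
      simp

namespace IsSkewPBWExtension

variable {A : Type*} [Ring A] {R : Subring A} {n : ℕ} {x : Fin n → A}

/-- The basis of the left `R`-module `A` consisting of the standard monomials. -/
noncomputable def basis (h : IsSkewPBWExtension R x) : Module.Basis (Fin n → ℕ) R A :=
  Module.Basis.mk h.linearIndependent h.span_eq_top.ge

theorem repr_linear (h : IsSkewPBWExtension R x) (i : Fin n) (c d : R) :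
    h.basis.repr ((c : A) * x i + d) =
      Finsupp.single (Pi.single i 1) c + Finsupp.single 0 d := by
  have h1 : (c : A) * x i + d = c • h.basis (Pi.single i 1) + d • h.basis 0 := by
    simp [basis, stdMonomial_zero, stdMonomial_single, Subring.smul_def]
  rw [h1]
  simp

theorem repr_linear_single (h : IsSkewPBWExtension R x) (i : Fin n) (c d : R) :
    h.basis.repr ((c : A) * x i + d) (Pi.single i 1) = c := by
  have : (0 : Fin n → ℕ) ≠ Pi.single i 1 := by
    intro e
    simpa using congrFun e i
  rw [repr_linear, Finsupp.add_apply, Finsupp.single_eq_same, Finsupp.single_apply, if_neg this,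
    add_zero]

theorem repr_linear_zero (h : IsSkewPBWExtension R x) (i : Fin n) (c d : R) :
    h.basis.repr ((c : A) * x i + d) 0 = d := by
  have : (Pi.single i 1 : Fin n → ℕ) ≠ 0 := by
    intro e
    simpa using congrFun e i
  rw [repr_linear, Finsupp.add_apply, Finsupp.single_eq_same, Finsupp.single_apply, if_neg this,
    zero_add]

theorem mul_eq_aux (h : IsSkewPBWExtension R x) (i : Fin n) (r : R) :
    x i * (r : A) = (h.basis.repr (x i * (r : A)) (Pi.single i 1) : A) * x i
      + (h.basis.repr (x i * (r : A)) 0 : A) := by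
  have hex : ∃ c d : R, x i * (r : A) = (c : A) * x i + d := by
    by_cases hr : r = 0
    · exact ⟨0, 0, by simp [hr]⟩
    · obtain ⟨c, -, hc⟩ := h.exists_coeff i r hr
      exact ⟨c, ⟨_, hc⟩, by simp⟩
  obtain ⟨c, d, e⟩ := hex
  rw [e, repr_linear_single, repr_linear_zero]

/-- The endomorphism `σ_i` of `R`, determined by `x_i r = σ_i(r) x_i + δ_i(r)`: `σ_i(r)` is the
coefficient of `x_i` in `x_i r`. -/
noncomputable def sigma (h : IsSkewPBWExtension R x) (i : Fin n) : R →+* R where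
  toFun r := h.basis.repr (x i * (r : A)) (Pi.single i 1)
  map_zero' := by simp
  map_add' r s := by simp [mul_add]
  map_one' := by
    have := h.repr_linear_single i 1 0
    simpa using this
  map_mul' r s := by
    have e : x i * ((r * s : R) : A) =
        ((h.basis.repr (x i * (r : A)) (Pi.single i 1)
          * h.basis.repr (x i * (s : A)) (Pi.single i 1) : R) : A) * x i
        + ((h.basis.repr (x i * (r : A)) (Pi.single i 1) * h.basis.repr (x i * (s : A)) 0
          + h.basis.repr (x i * (r : A)) 0 * s : R) : A) := by
      have h1 := h.mul_eq_aux i r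
      have h2 := h.mul_eq_aux i s
      generalize h.basis.repr (x i * (r : A)) (Pi.single i 1) = a at *
      generalize h.basis.repr (x i * (r : A)) 0 = b at *
      generalize h.basis.repr (x i * (s : A)) (Pi.single i 1) = c at *
      generalize h.basis.repr (x i * (s : A)) 0 = d at *
      push_cast
      rw [← mul_assoc, h1, add_mul, mul_assoc, h2]
      noncomm_ring
    rw [e, repr_linear_single]

/-- The `σ_i`-derivation `δ_i` of `R`, determined by `x_i r = σ_i(r) x_i + δ_i(r)`: `δ_i(r)` is
the constant coefficient of `x_i r`. -/
noncomputable def delta (h : IsSkewPBWExtension R x) (i : Fin n) : R →+ R where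
  toFun r := h.basis.repr (x i * (r : A)) 0
  map_zero' := by simp
  map_add' r s := by simp [mul_add]

theorem x_mul (h : IsSkewPBWExtension R x) (i : Fin n) (r : R) :
    x i * (r : A) = (h.sigma i r : A) * x i + (h.delta i r : A) :=
  h.mul_eq_aux i r

/-- `σ^α = σ_1^{α_1} ∘ ⋯ ∘ σ_n^{α_n}`. -/
noncomputable def sigmaPow (h : IsSkewPBWExtension R x) (α : Fin n → ℕ) : R → R :=
  (List.ofFn fun i => (h.sigma i)^[α i]).foldr (fun f g => f ∘ g) id

/-- `δ^β = δ_1^{β_1} ∘ ⋯ ∘ δ_n^{β_n}`. -/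
noncomputable def deltaPow (h : IsSkewPBWExtension R x) (β : Fin n → ℕ) : R → R :=
  (List.ofFn fun i => (h.delta i)^[β i]).foldr (fun f g => f ∘ g) id

/-- `R` is `Σ`-compatible. -/
def SigmaCompatible (h : IsSkewPBWExtension R x) : Prop :=
  ∀ (a b : R) (α : Fin n → ℕ), a * h.sigmaPow α b = 0 ↔ a * b = 0

/-- `R` is `Δ`-compatible. -/
def DeltaCompatible (h : IsSkewPBWExtension R x) : Prop :=
  ∀ (a b : R) (β : Fin n → ℕ), a * b = 0 → a * h.deltaPow β b = 0

/-- `R` is `(Σ, Δ)`-compatible. -/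
def Compatible (h : IsSkewPBWExtension R x) : Prop :=
  h.SigmaCompatible ∧ h.DeltaCompatible

end IsSkewPBWExtension

/-! Suppose first that `R` is not reduced, and take `a ≠ 0` with `a² = 0`. Nilpotents of a 2-primal
ring form an ideal, so a second non-zero nilpotent `b` would give a triangle `a, b, 1` in the graph
of `R`; hence `nil(R) = {0, a}`. Compatibility gives `a x_i a = 0`, so `a, a x_i, 1` is a triangle
in the graph of `A`.

Suppose now that `R` is reduced. If `ab = 0` with `a, b ≠ 0`, then `a, b, a x_i, b x_i` is a 4-cycle
in the graph of `A`. Triangles are excluded by leading terms for the degree-lexicographic order: by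
`HasLead.mul_eq_zero`, `fg = 0` forces the product of the leading coefficients to vanish. This makes
`A` reduced, and a triangle in `A` would descend to a triangle of leading coefficients in `R`.

The delicate point is that reordering variables introduces coefficients, which must not kill
anything. They are units: comparing the commutation relations for `(i, j)` and `(j, i)` gives `d' d
= 1`, and one-sided inverses in a reduced ring are two-sided. -/

/-! ### Degree-lexicographic order on exponents -/

/-- The degree-lexicographic weight of an exponent. -/
def degLexWeight {n : ℕ} (α : Fin n → ℕ) : ℕ ×ₗ Lex (Fin n → ℕ) :=
  toLex (∑ i, α i, toLex α)

theorem degLexWeight_add {n : ℕ} (α β : Fin n → ℕ) :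
    degLexWeight (α + β) = degLexWeight α + degLexWeight β := by
  unfold degLexWeight
  rw [← toLex_add, Prod.mk_add_mk, ← toLex_add, ← Finset.sum_add_distrib]
  rfl

theorem degLexWeight_injective {n : ℕ} :
    Function.Injective (degLexWeight : (Fin n → ℕ) → ℕ ×ₗ Lex (Fin n → ℕ)) := by
  intro α β h
  exact toLex.injective (congrArg Prod.snd (toLex.injective h))

theorem degLexWeight_add_lt_right {n : ℕ} {α β : Fin n → ℕ}
    (h : degLexWeight α < degLexWeight β) (γ : Fin n → ℕ) :
    degLexWeight (α + γ) < degLexWeight (β + γ) := by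
  rw [degLexWeight_add, degLexWeight_add]
  exact add_lt_add_left h _

theorem degLexWeight_lt_of_sum_lt {n : ℕ} {α β : Fin n → ℕ} (h : ∑ i, α i < ∑ i, β i) :
    degLexWeight α < degLexWeight β :=
  Prod.Lex.toLex_lt_toLex.2 (Or.inl h)

theorem sum_le_of_degLexWeight_lt {n : ℕ} {α β : Fin n → ℕ}
    (h : degLexWeight α < degLexWeight β) : ∑ i, α i ≤ ∑ i, β i := by
  rcases Prod.Lex.toLex_lt_toLex.1 h with h | h
  · exact h.le
  · exact h.1.le

theorem sum_add_single {n : ℕ} (α : Fin n → ℕ) (i : Fin n) :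
    ∑ k, (α + Pi.single i 1 : Fin n → ℕ) k = ∑ k, α k + 1 := by
  simp [Finset.sum_add_distrib]

theorem degLexWeight_lt_add_single {n : ℕ} (α : Fin n → ℕ) (i : Fin n) :
    degLexWeight α < degLexWeight (α + Pi.single i 1) :=
  degLexWeight_lt_of_sum_lt (by rw [sum_add_single]; omega)

/-- A non-zero exponent loses one from its first non-zero entry. -/
theorem exists_eq_add_single_first {n : ℕ} {α : Fin n → ℕ} (h : α ≠ 0) :
    ∃ (j : Fin n) (β : Fin n → ℕ), α = β + Pi.single j 1 ∧ ∀ k < j, β k = 0 := by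
  have hs : (Finset.univ.filter fun i => α i ≠ 0).Nonempty := by
    obtain ⟨i, hi⟩ := Function.ne_iff.1 h
    exact ⟨i, by simpa using hi⟩
  obtain ⟨j, hj, hmin⟩ := Finset.exists_min_image _ id hs
  simp only [Finset.mem_filter, Finset.mem_univ, true_and, id] at hj hmin
  refine ⟨j, α - Pi.single j 1, ?_, fun k hk => ?_⟩
  · funext k
    by_cases hk : k = j
    · subst hk
      simp only [Pi.add_apply, Pi.sub_apply, Pi.single_eq_same]
      omega
    · simp [hk]
  · by_contra hne
    have : α k ≠ 0 := fun h0 => hne (by simp [h0])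
    exact absurd (hmin k this) (not_le.2 hk)

/-- A variable no later than any occurring in the monomial can be put in front without commuting
anything; this drives every induction on exponents below. -/
theorem stdMonomial_add_single {A : Type*} [Ring A] {n : ℕ} (x : Fin n → A) (α : Fin n → ℕ)
    (j : Fin n) (h : ∀ k < j, α k = 0) :
    stdMonomial x (α + Pi.single j 1) = x j * stdMonomial x α := by
  induction n with
  | zero => exact j.elim0
  | succ n ih =>
    have hcons : ∀ β : Fin (n + 1) → ℕ, stdMonomial x β =
        x 0 ^ β 0 * stdMonomial (fun k => x k.succ) (fun k => β k.succ) := by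
      intro β
      simp [stdMonomial, List.ofFn_succ]
    rw [hcons, hcons]
    induction j using Fin.cases with
    | zero =>
      have e : (fun k : Fin n => (α + Pi.single 0 1 : Fin (n + 1) → ℕ) k.succ)
          = fun k => α k.succ := by
        funext k
        simp
      rw [e]
      simp [pow_succ', mul_assoc]
    | succ j =>
      have h0 : α 0 = 0 := h 0 (Fin.succ_pos j)
      have e : (fun k : Fin n => (α + Pi.single j.succ 1 : Fin (n + 1) → ℕ) k.succ)
          = (fun k => α k.succ) + Pi.single j 1 := by
        funext k
        simp [Pi.single_apply]
      rw [e, ih (fun k => x k.succ) _ j fun k hk => h k.succ (Fin.succ_lt_succ_iff.2 hk)]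
      simp [h0]

theorem foldr_comp_iterate_single {S : Type*} {n : ℕ} (f : Fin n → S → S) (i : Fin n) :
    (List.ofFn fun k => (f k)^[(Pi.single i 1 : Fin n → ℕ) k]).foldr (fun f g => f ∘ g) id
      = f i := by
  induction n with
  | zero => exact i.elim0
  | succ n ih =>
    have hzero : ∀ {m : ℕ}, (List.ofFn fun _ : Fin m => (id : S → S)).foldr
        (fun f g => f ∘ g) id = id := by
      intro m
      induction m with
      | zero => simp
      | succ m ih => rw [List.ofFn_succ, List.foldr_cons, ih]; rfl
    rw [List.ofFn_succ, List.foldr_cons]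
    induction i using Fin.cases with
    | zero =>
      have e : (fun k : Fin n => (f k.succ)^[(Pi.single 0 1 : Fin (n + 1) → ℕ) k.succ])
          = fun _ => id := by
        funext k
        simp
      rw [e, hzero]
      simp
    | succ j =>
      have e : (fun k : Fin n => (f k.succ)^[(Pi.single j.succ 1 : Fin (n + 1) → ℕ) k.succ])
          = fun k => (f k.succ)^[(Pi.single j 1 : Fin n → ℕ) k] := by
        funext k
        simp [Pi.single_apply]
      rw [e, ih (fun k => f k.succ) j]
      simp

/-! ### Reduced rings -/

/-- The element `(1 - ba)a` squares to zero because `a(1 - ba) = 0`; once it vanishes, multiplying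
by `b` on the right gives `ba = 1`. -/
theorem isUnit_of_mul_eq_one_of_isReduced {S : Type*} [Ring S] [IsReduced S] {a b : S}
    (h : a * b = 1) : IsUnit b := by
  have h1 : a * (1 - b * a) = 0 := by
    rw [mul_sub, mul_one, ← mul_assoc, h, one_mul, sub_self]
  have h2 : (1 - b * a) * a = 0 := by
    refine IsReduced.eq_zero _ ⟨2, ?_⟩
    rw [pow_two, mul_assoc, ← mul_assoc a, h1, zero_mul, mul_zero]
  have h3 : 1 - b * a = 0 := by
    calc 1 - b * a = (1 - b * a) * a * b := by rw [mul_assoc, h, mul_one]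
      _ = 0 := by rw [h2, zero_mul]
  exact ⟨⟨b, a, (sub_eq_zero.1 h3).symm, h⟩, rfl⟩

theorem mul_eq_zero_symm_of_isReduced {S : Type*} [Ring S] [IsReduced S] {a b : S}
    (h : a * b = 0) : b * a = 0 :=
  IsReduced.eq_zero _ ⟨2, by rw [pow_two, mul_assoc, ← mul_assoc a, h, zero_mul, mul_zero]⟩

theorem mem_nilSet_iff_of_isReduced {S : Type*} [Ring S] [IsReduced S] {a : S} :
    a ∈ nilSet S ↔ a = 0 :=
  isNilpotent_iff_eq_zero

/-! ### Leading coefficients -/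

namespace IsSkewPBWExtension

variable {A : Type*} [Ring A] {R : Subring A} {n : ℕ} {x : Fin n → A}

theorem SigmaCompatible.mul_sigma_eq_zero {h : IsSkewPBWExtension R x} (hσ : h.SigmaCompatible)
    (i : Fin n) (a b : R) : a * h.sigma i b = 0 ↔ a * b = 0 := by
  have := hσ a b (Pi.single i 1)
  rwa [sigmaPow, foldr_comp_iterate_single (fun k => h.sigma k) i] at this

theorem DeltaCompatible.mul_delta_eq_zero {h : IsSkewPBWExtension R x} (hδ : h.DeltaCompatible)
    (i : Fin n) {a b : R} (hab : a * b = 0) : a * h.delta i b = 0 := by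
  have := hδ a b (Pi.single i 1) hab
  rwa [deltaPow, foldr_comp_iterate_single (fun k => h.delta k) i] at this

/-- The left `R`-submodule spanned by the standard monomials below `x^γ`. -/
def lower (R : Subring A) (x : Fin n → A) (γ : Fin n → ℕ) : Submodule R A :=
  Submodule.span R (stdMonomial x '' {β | degLexWeight β < degLexWeight γ})

theorem stdMonomial_mem_lower {β γ : Fin n → ℕ} (h : degLexWeight β < degLexWeight γ) :
    stdMonomial x β ∈ lower R x γ :=
  Submodule.subset_span ⟨β, h, rfl⟩

theorem lower_mono {β γ : Fin n → ℕ} (h : degLexWeight β ≤ degLexWeight γ) :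
    lower R x β ≤ lower R x γ :=
  Submodule.span_mono (Set.image_mono fun _ hα => lt_of_lt_of_le hα h)

theorem basis_apply (h : IsSkewPBWExtension R x) (α : Fin n → ℕ) :
    h.basis α = stdMonomial x α := by
  simp [basis]

theorem repr_eq_zero_of_mem_lower (h : IsSkewPBWExtension R x) {γ : Fin n → ℕ} {f : A}
    (hf : f ∈ lower R x γ) : h.basis.repr f γ = 0 := by
  induction hf using Submodule.span_induction with
  | mem y hy =>
    obtain ⟨β, hβ, rfl⟩ := hy
    rw [← h.basis_apply, Module.Basis.repr_self, Finsupp.single_apply, if_neg]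
    rintro rfl
    exact lt_irrefl (degLexWeight β) hβ
  | zero => simp
  | add y z _ _ hy hz => simp [hy, hz]
  | smul r y _ hy => simp [hy]

/-- `a x^α` is the leading term of `f` (or `a = 0` and all terms of `f` are below `x^α`). -/
def HasLead (R : Subring A) (x : Fin n → A) (f : A) (α : Fin n → ℕ) (a : R) : Prop :=
  f - a • stdMonomial x α ∈ lower R x α

theorem HasLead.repr_eq (h : IsSkewPBWExtension R x) {f : A} {α : Fin n → ℕ} {a : R}
    (hf : HasLead R x f α a) : h.basis.repr f α = a := by
  have := h.repr_eq_zero_of_mem_lower hf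
  rw [← h.basis_apply] at this
  simpa [sub_eq_zero] using this

theorem HasLead.mem_lower {f : A} {α γ : Fin n → ℕ} {a : R} (hf : HasLead R x f α a)
    (h : degLexWeight α < degLexWeight γ) : f ∈ lower R x γ := by
  have := add_mem (lower_mono h.le hf) (Submodule.smul_mem _ a (stdMonomial_mem_lower h))
  simpa using this

theorem hasLead_of_mem_lower_add {f g : A} {α : Fin n → ℕ} {a : R} (hf : HasLead R x f α a)
    (hg : g ∈ lower R x α) : HasLead R x (f + g) α a := by
  have := add_mem hf hg
  rwa [sub_add_eq_add_sub] at this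

theorem HasLead.smul {f : A} {α : Fin n → ℕ} {a : R} (hf : HasLead R x f α a) (r : R) :
    HasLead R x (r • f) α (r * a) := by
  have := Submodule.smul_mem _ r hf
  rwa [smul_sub, smul_smul] at this

theorem hasLead_stdMonomial (α : Fin n → ℕ) : HasLead R x (stdMonomial x α) α 1 := by
  simp [HasLead]

theorem exists_hasLead (h : IsSkewPBWExtension R x) {f : A} (hf : f ≠ 0) :
    ∃ (α : Fin n → ℕ) (a : R), a ≠ 0 ∧ HasLead R x f α a := by
  have hs : (h.basis.repr f).support.Nonempty := by
    rw [Finsupp.support_nonempty_iff]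
    simpa using hf
  obtain ⟨α, hα, hmax⟩ := Finset.exists_max_image _ degLexWeight hs
  refine ⟨α, h.basis.repr f α, Finsupp.mem_support_iff.1 hα, ?_⟩
  have hsum : f = ∑ β ∈ (h.basis.repr f).support, h.basis.repr f β • stdMonomial x β := by
    conv_lhs => rw [← h.basis.linearCombination_repr f]
    simp [Finsupp.linearCombination_apply, Finsupp.sum, basis_apply]
  have key : f - h.basis.repr f α • stdMonomial x α =
      ∑ β ∈ (h.basis.repr f).support.erase α, h.basis.repr f β • stdMonomial x β := by
    rw [sub_eq_iff_eq_add, Finset.sum_erase_add _ _ hα]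
    exact hsum
  rw [HasLead, key]
  refine Submodule.sum_mem _ fun β hβ => Submodule.smul_mem _ _ (stdMonomial_mem_lower ?_)
  obtain ⟨hne, hmem⟩ := Finset.mem_erase.1 hβ
  exact lt_of_le_of_ne (hmax β hmem) fun e => hne (degLexWeight_injective e)

theorem x_mul_smul (h : IsSkewPBWExtension R x) (i : Fin n) (r : R) (f : A) :
    x i * (r • f) = h.sigma i r • (x i * f) + h.delta i r • f := by
  simp only [Subring.smul_def, smul_eq_mul]
  rw [← mul_assoc, h.x_mul, add_mul, mul_assoc]

/-- The behaviour on monomials is a hypothesis `H`, restricted to those below `x^γ`, so that the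
lemma can be used inside the induction that establishes this behaviour. -/
theorem x_mul_mem_lower (h : IsSkewPBWExtension R x) (i : Fin n) (γ : Fin n → ℕ)
    (H : ∀ β, degLexWeight β < degLexWeight γ →
      ∃ u : R, HasLead R x (x i * stdMonomial x β) (β + Pi.single i 1) u)
    {f : A} (hf : f ∈ lower R x γ) : x i * f ∈ lower R x (γ + Pi.single i 1) := by
  -- Left multiplication by `x_i` is not `R`-linear, so scalars are only attached to single
  -- monomials, where the extra `δ_i` term is visibly low.
  induction hf using Submodule.closure_induction with
  | zero => simp
  | add y z _ _ hy hz => rw [mul_add]; exact add_mem hy hz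
  | smul_mem r y hy =>
    obtain ⟨β, hβ, rfl⟩ := hy
    obtain ⟨u, hu⟩ := H β hβ
    rw [x_mul_smul h]
    exact add_mem (Submodule.smul_mem _ _ (hu.mem_lower (degLexWeight_add_lt_right hβ _)))
      (Submodule.smul_mem _ _ (stdMonomial_mem_lower
        (lt_trans hβ (degLexWeight_lt_add_single γ i))))

/-- The commutation coefficients of a skew PBW extension of a reduced ring are units. -/
theorem exists_isUnit_comm (h : IsSkewPBWExtension R x) [IsReduced R] {j i : Fin n}
    (hji : j < i) : ∃ d : R, IsUnit d ∧ ∃ (r₀ : R) (r : Fin n → R),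
      x i * x j = d • (x j * x i) + (r₀ • (1 : A) + ∑ k, r k • x k) := by
  obtain ⟨d, -, r₀, r, hd⟩ := h.exists_comm j i
  obtain ⟨d', -, s₀, s, hd'⟩ := h.exists_comm i j
  rw [sub_eq_iff_eq_add'] at hd hd'
  have e : x i * x j = d • (x j * x i) + (r₀ • (1 : A) + ∑ k, r k • x k) := by
    rw [hd]; simp [Subring.smul_def]
  have e' : x j * x i = d' • (x i * x j) + (s₀ • (1 : A) + ∑ k, s k • x k) := by
    rw [hd']; simp [Subring.smul_def]
  refine ⟨d, isUnit_of_mul_eq_one_of_isReduced (a := d') ?_, r₀, r, e⟩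
  -- Since `j < i`, the product `x_j x_i` is already standard.
  have hm : x j * x i = stdMonomial x (Pi.single i 1 + Pi.single j 1) := by
    rw [stdMonomial_add_single, stdMonomial_single]
    intro k hk
    exact Pi.single_eq_of_ne (hk.trans hji).ne 1
  have hlin : ∀ (t₀ : R) (t : Fin n → R),
      t₀ • (1 : A) + ∑ k, t k • x k ∈ lower R x (Pi.single i 1 + Pi.single j 1) := by
    intro t₀ t
    refine add_mem (Submodule.smul_mem _ _ ?_) (Submodule.sum_mem _ fun k _ =>
      Submodule.smul_mem _ _ ?_)
    · rw [← stdMonomial_zero x]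
      exact stdMonomial_mem_lower (degLexWeight_lt_of_sum_lt (by rw [sum_add_single]; simp))
    · rw [← stdMonomial_single x k]
      exact stdMonomial_mem_lower (degLexWeight_lt_of_sum_lt (by rw [sum_add_single]; simp))
  -- Substituting one relation into the other expresses `x_j x_i` as `d' d x_j x_i` plus terms of
  -- degree at most one; uniqueness of the coefficient gives `d' d = 1`.
  rw [e, hm] at e'
  have h1 : HasLead R x (stdMonomial x (Pi.single i 1 + Pi.single j 1))
      (Pi.single i 1 + Pi.single j 1) (d' * (d * 1)) := by
    conv => arg 3; rw [e']
    exact hasLead_of_mem_lower_add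
      ((hasLead_of_mem_lower_add ((hasLead_stdMonomial _).smul d) (hlin _ _)).smul d') (hlin _ _)
  rw [← mul_one d, ← h1.repr_eq h, (hasLead_stdMonomial _).repr_eq h]

/-- Induction on the degree of `β`, then on the index `i`. If `x^β = x_j x^α` with `j < i`, swap
`x_i x_j` at the cost of a unit and linear terms, expand `x_i x^α` by the degree induction, and
multiply by `x_j`. Ring endomorphisms preserve units, so `σ_j` does no harm. -/
theorem exists_isUnit_hasLead_x_mul_stdMonomial (h : IsSkewPBWExtension R x) [IsReduced R]
    (i : Fin n) (β : Fin n → ℕ) :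
    ∃ u : R, IsUnit u ∧ HasLead R x (x i * stdMonomial x β) (β + Pi.single i 1) u := by
  induction hd : ∑ k, β k using Nat.strong_induction_on generalizing i β with
  | _ d ihd =>
  subst hd
  induction hi : (i : ℕ) using Nat.strong_induction_on generalizing i β with
  | _ m ihi =>
  subst hi
  by_cases hz : ∀ k < i, β k = 0
  · refine ⟨1, isUnit_one, ?_⟩
    rw [← stdMonomial_add_single x β i hz]
    exact hasLead_stdMonomial _
  have hβ : β ≠ 0 := by
    rintro rfl
    exact hz fun _ _ => rfl
  obtain ⟨j, α, rfl, hα⟩ := exists_eq_add_single_first hβ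
  have hji : j < i := by
    by_contra hle
    refine hz fun k hk => ?_
    have hkj : k < j := hk.trans_le (not_lt.1 hle)
    simp [hα k hkj, hkj.ne]
  have hαlt : ∑ k, α k < ∑ k, (α + Pi.single j 1 : Fin n → ℕ) k := by
    rw [sum_add_single]; omega
  have hcomm : α + Pi.single i 1 + Pi.single j 1 = α + Pi.single j 1 + Pi.single i 1 :=
    add_right_comm _ _ _
  obtain ⟨c, hc, r₀, r, hcomm'⟩ := h.exists_isUnit_comm hji
  obtain ⟨u, hu, hlead⟩ := ihd _ hαlt i α rfl
  -- the main term
  have hmain : HasLead R x (x j * (x i * stdMonomial x α))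
      (α + Pi.single j 1 + Pi.single i 1) (h.sigma j u) := by
    have hlow : x j * (x i * stdMonomial x α - u • stdMonomial x (α + Pi.single i 1)) ∈
        lower R x (α + Pi.single i 1 + Pi.single j 1) := by
      refine h.x_mul_mem_lower j _ (fun γ hγ => ?_) hlead
      have hle := sum_le_of_degLexWeight_lt hγ
      rw [sum_add_single, ← sum_add_single α j] at hle
      -- Terms below the leading one may still have the full degree of `β`; for these the smaller
      -- index `j < i` makes the inner induction apply. That induction carries the degree hypothesis
      -- along, which is transported across the equality of degrees.
      rcases hle.lt_or_eq with hlt | heq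
      · obtain ⟨v, -, hv⟩ := ihd _ hlt j γ rfl
        exact ⟨v, hv⟩
      · obtain ⟨v, -, hv⟩ := ihi (j : ℕ) hji j γ (fun m hm => ihd m (hm.trans_eq heq)) rfl
        exact ⟨v, hv⟩
    rw [hcomm] at hlow
    have hz' : ∀ k < j, (α + Pi.single i 1 : Fin n → ℕ) k = 0 := fun k hk => by
      simp [hα k hk, (hk.trans hji).ne]
    have e : x j * (x i * stdMonomial x α) =
        (h.sigma j u • stdMonomial x (α + Pi.single j 1 + Pi.single i 1) +
          h.delta j u • stdMonomial x (α + Pi.single i 1)) +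
        x j * (x i * stdMonomial x α - u • stdMonomial x (α + Pi.single i 1)) := by
      rw [mul_sub, h.x_mul_smul, ← stdMonomial_add_single x _ j hz', hcomm]
      abel
    rw [e]
    refine hasLead_of_mem_lower_add (hasLead_of_mem_lower_add ?_ ?_) hlow
    · simp [HasLead]
    · refine Submodule.smul_mem _ _ (stdMonomial_mem_lower ?_)
      rw [← hcomm]
      exact degLexWeight_lt_add_single _ _
  refine ⟨c * h.sigma j u, hc.mul (hu.map _), ?_⟩
  have e : x i * stdMonomial x (α + Pi.single j 1) =
      c • (x j * (x i * stdMonomial x α)) +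
        (r₀ • stdMonomial x α + ∑ k, r k • (x k * stdMonomial x α)) := by
    rw [stdMonomial_add_single x α j hα, ← mul_assoc, hcomm']
    simp only [add_mul, Finset.sum_mul, smul_mul_assoc, one_mul, mul_assoc]
  rw [e]
  refine hasLead_of_mem_lower_add (hmain.smul c) (add_mem (Submodule.smul_mem _ _ ?_)
    (Submodule.sum_mem _ fun k _ => Submodule.smul_mem _ _ ?_))
  · exact stdMonomial_mem_lower ((degLexWeight_lt_add_single _ j).trans
      (degLexWeight_lt_add_single _ i))
  · obtain ⟨v, -, hv⟩ := ihd _ hαlt k α rfl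
    refine hv.mem_lower (degLexWeight_lt_of_sum_lt ?_)
    simp only [sum_add_single]
    omega

/-- The new coefficient is `σ_i(b) u` with `u` a unit, so compatibility preserves the left
annihilator of `b`. Tracking annihilators instead of coefficients makes the statement iterable. -/
theorem HasLead.x_mul (h : IsSkewPBWExtension R x) [IsReduced R] (hσ : h.SigmaCompatible)
    (i : Fin n) {g : A} {β : Fin n → ℕ} {b : R} (hg : HasLead R x g β b) :
    ∃ b' : R, (∀ a, a * b' = 0 ↔ a * b = 0) ∧
      HasLead R x (x i * g) (β + Pi.single i 1) b' := by
  obtain ⟨u, hu, hlead⟩ := h.exists_isUnit_hasLead_x_mul_stdMonomial i β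
  refine ⟨h.sigma i b * u, fun a => ?_, ?_⟩
  · rw [← mul_assoc, hu.mul_left_eq_zero, hσ.mul_sigma_eq_zero]
  have hlow : x i * (g - b • stdMonomial x β) ∈ lower R x (β + Pi.single i 1) :=
    h.x_mul_mem_lower i β (fun γ _ => by
      obtain ⟨v, -, hv⟩ := h.exists_isUnit_hasLead_x_mul_stdMonomial i γ
      exact ⟨v, hv⟩) hg
  have e : x i * g = h.sigma i b • (x i * stdMonomial x β) +
      (h.delta i b • stdMonomial x β + x i * (g - b • stdMonomial x β)) := by
    rw [mul_sub, h.x_mul_smul]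
    abel
  rw [e]
  exact hasLead_of_mem_lower_add (hlead.smul _) (add_mem (Submodule.smul_mem _ _
    (stdMonomial_mem_lower (degLexWeight_lt_add_single β i))) hlow)

theorem HasLead.stdMonomial_mul (h : IsSkewPBWExtension R x) [IsReduced R]
    (hσ : h.SigmaCompatible) (α : Fin n → ℕ) {g : A} {β : Fin n → ℕ} {b : R}
    (hg : HasLead R x g β b) :
    ∃ b' : R, (∀ a, a * b' = 0 ↔ a * b = 0) ∧
      HasLead R x (stdMonomial x α * g) (α + β) b' := by
  induction hd : ∑ k, α k using Nat.strong_induction_on generalizing α with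
  | _ d ih =>
  subst hd
  by_cases hα : α = 0
  · subst hα
    exact ⟨b, fun _ => Iff.rfl, by simpa [stdMonomial_zero] using hg⟩
  obtain ⟨j, γ, rfl, hγ⟩ := exists_eq_add_single_first hα
  obtain ⟨b₁, hb₁, hlead₁⟩ := ih _ (by rw [sum_add_single]; omega) γ rfl
  obtain ⟨b₂, hb₂, hlead₂⟩ := hlead₁.x_mul h hσ j
  refine ⟨b₂, fun a => (hb₂ a).trans (hb₁ a), ?_⟩
  rwa [stdMonomial_add_single x γ j hγ, mul_assoc, add_right_comm]

theorem HasLead.mul (h : IsSkewPBWExtension R x) [IsReduced R] (hσ : h.SigmaCompatible)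
    {f g : A} {α β : Fin n → ℕ} {a b : R} (hf : HasLead R x f α a) (hg : HasLead R x g β b) :
    ∃ c : R, (c = 0 ↔ a * b = 0) ∧ HasLead R x (f * g) (α + β) c := by
  obtain ⟨b', hb', hlead⟩ := hg.stdMonomial_mul h hσ α
  refine ⟨a * b', hb' a, ?_⟩
  have hlow : ∀ p ∈ lower R x α, p * g ∈ lower R x (α + β) := by
    intro p hp
    induction hp using Submodule.span_induction with
    | mem y hy =>
      obtain ⟨γ, hγ, rfl⟩ := hy
      obtain ⟨c, -, hc⟩ := hg.stdMonomial_mul h hσ γ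
      exact hc.mem_lower (degLexWeight_add_lt_right hγ β)
    | zero => simp
    | add y z _ _ hy hz => rw [add_mul]; exact add_mem hy hz
    | smul r y _ hy => rw [smul_mul_assoc]; exact Submodule.smul_mem _ _ hy
  have e : f * g = a • (stdMonomial x α * g) + (f - a • stdMonomial x α) * g := by
    rw [sub_mul, smul_mul_assoc]
    abel
  rw [e]
  exact hasLead_of_mem_lower_add (hlead.smul a) (hlow _ hf)

theorem HasLead.mul_eq_zero (h : IsSkewPBWExtension R x) [IsReduced R] (hσ : h.SigmaCompatible)
    {f g : A} {α β : Fin n → ℕ} {a b : R} (hf : HasLead R x f α a) (hg : HasLead R x g β b)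
    (hfg : f * g = 0) : a * b = 0 := by
  obtain ⟨c, hc, hlead⟩ := hf.mul h hσ hg
  have := hlead.repr_eq h
  rw [hfg] at this
  exact hc.1 (by simpa using this.symm)

/-- A `Σ`-compatible skew PBW extension of a reduced ring is reduced. -/
theorem isReduced (h : IsSkewPBWExtension R x) [IsReduced R] (hσ : h.SigmaCompatible) :
    IsReduced A := by
  refine (isReduced_iff_pow_one_lt 2 one_lt_two).2 fun f hf => ?_
  by_contra hne
  obtain ⟨α, a, ha, hlead⟩ := h.exists_hasLead hne
  have := hlead.mul_eq_zero h hσ hlead (by rwa [← pow_two])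
  exact ha (IsReduced.eq_zero _ ⟨2, by rwa [pow_two]⟩)

/-! ### Elements of degree at most one -/

/-- Used to show that the vertices of the explicit cycles are non-zero and distinct. -/
theorem coe_eq_mul_x_iff (h : IsSkewPBWExtension R x) (i : Fin n) {a b : R} :
    (a : A) = (b : A) * x i ↔ a = 0 ∧ b = 0 := by
  refine ⟨fun e => ?_, fun ⟨ha, hb⟩ => by simp [ha, hb]⟩
  have h1 := h.repr_linear_zero i 0 a
  have h2 := h.repr_linear_zero i b 0
  have h3 := h.repr_linear_single i 0 a
  have h4 := h.repr_linear_single i b 0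
  simp only [ZeroMemClass.coe_zero, zero_mul, zero_add, add_zero, ← e] at h1 h2 h3 h4
  exact ⟨h1.symm.trans h2, h4.symm.trans h3⟩

theorem mul_x_inj (h : IsSkewPBWExtension R x) (i : Fin n) {a b : R}
    (e : (a : A) * x i = (b : A) * x i) : a = b := by
  have := h.coe_eq_mul_x_iff i (a := 0) (b := a - b)
  rw [← sub_eq_zero]
  refine (this.1 ?_).2
  push_cast
  rw [sub_mul, e, sub_self]

/-- Expanding, `a x_i b = a σ_i(b) x_i + a δ_i(b)`, and each half of compatibility kills one term.
-/
theorem Compatible.mul_x_mul_eq_zero {h : IsSkewPBWExtension R x} (hc : h.Compatible) (i : Fin n)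
    {a b : R} (hab : a * b = 0) : (a : A) * x i * (b : A) = 0 := by
  have h1 := (hc.1.mul_sigma_eq_zero i a b).2 hab
  have h2 := hc.2.mul_delta_eq_zero i hab
  rw [mul_assoc, h.x_mul, mul_add, ← mul_assoc, ← Subring.coe_mul, ← Subring.coe_mul, h1, h2]
  simp

end IsSkewPBWExtension

/-! ### Short cycles in the nilpotent graph -/

theorem mem_nilZeroDivisors_of_mul {S : Type*} [Ring S] {a b : S} (ha : a ≠ 0) (hb : b ≠ 0)
    (h : a * b ∈ nilSet S) : a ∈ nilZeroDivisors S :=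
  ⟨ha, b, hb, h⟩

theorem SimpleGraph.egirth_eq_three_of_triangle {V : Type*} {G : SimpleGraph V} {a b c : V}
    (hab : G.Adj a b) (hac : G.Adj a c) (hbc : G.Adj b c) : G.egirth = 3 := by
  classical
  obtain ⟨u, w, hw, hl⟩ := SimpleGraph.is3Clique_iff_exists_cycle_length_three.1
    ⟨_, SimpleGraph.is3Clique_triple_iff.2 ⟨hab, hac, hbc⟩⟩
  refine le_antisymm ?_ SimpleGraph.three_le_egirth
  have := SimpleGraph.le_egirth.1 le_rfl u w hw
  rwa [hl] at this

theorem SimpleGraph.egirth_eq_four {V : Type*} {G : SimpleGraph V}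
    (htri : ∀ a b c, G.Adj a b → G.Adj a c → ¬ G.Adj b c) {a b c d : V} (hab : G.Adj a b)
    (hbc : G.Adj b c) (hcd : G.Adj c d) (hda : G.Adj d a) (hac : a ≠ c) (hbd : b ≠ d) :
    G.egirth = 4 := by
  classical
  refine le_antisymm ?_ (SimpleGraph.le_egirth.2 fun u w hw => ?_)
  · let w : G.Walk a a := .cons hab (.cons hbc (.cons hcd (.cons hda .nil)))
    have hw : w.IsCycle := by
      simp [w, SimpleGraph.Walk.isCycle_def, hab.ne, hab.ne', hbc.ne, hcd.ne, hda.ne,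
        hda.ne', hac, hac.symm, hbd]
    exact SimpleGraph.le_egirth.1 le_rfl a w hw
  · have h3 := hw.three_le_length
    have hne : w.length ≠ 3 := fun hl => by
      obtain ⟨s, hs⟩ := SimpleGraph.is3Clique_iff_exists_cycle_length_three.2 ⟨u, w, hw, hl⟩
      obtain ⟨a, b, c, h1, h2, h3, -⟩ := SimpleGraph.is3Clique_iff.1 hs
      exact htri a b c h1 h2 h3
    have : 4 ≤ w.length := by omega
    exact_mod_cast this

theorem nilpotentGraph_egirth_eq_three {S : Type*} [Ring S] {a b c : S} (ha : a ≠ 0) (hb : b ≠ 0)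
    (hc : c ≠ 0) (hab : a ≠ b) (hac : a ≠ c) (hbc : b ≠ c) (h1 : a * b ∈ nilSet S)
    (h2 : a * c ∈ nilSet S) (h3 : b * c ∈ nilSet S) : (nilpotentGraph S).egirth = 3 :=
  SimpleGraph.egirth_eq_three_of_triangle
    (a := ⟨a, mem_nilZeroDivisors_of_mul ha hb h1⟩) (b := ⟨b, mem_nilZeroDivisors_of_mul hb hc h3⟩)
    (c := ⟨c, mem_nilZeroDivisors_of_mul hc hb (mul_mem_nilSet_symm h3)⟩)
    ⟨fun e => hab (congrArg Subtype.val e), h1⟩ ⟨fun e => hac (congrArg Subtype.val e), h2⟩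
    ⟨fun e => hbc (congrArg Subtype.val e), h3⟩

/-- In a 2-primal ring, the nilpotent elements absorb multiplication on the right. -/
theorem IsTwoPrimal.mul_mem_nilSet {S : Type*} [Ring S] (h : IsTwoPrimal S) {a : S}
    (ha : a ∈ nilSet S) (b : S) : a * b ∈ nilSet S := by
  rw [IsTwoPrimal] at h
  rw [← h] at ha ⊢
  exact (primeRadical S).mul_mem_right _ _ ha

/-- A 2-primal ring whose nilpotent graph has no triangle has at most one non-zero nilpotent. -/
theorem IsTwoPrimal.nilSet_eq_pair {S : Type*} [Ring S] (h : IsTwoPrimal S)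
    (hg : (nilpotentGraph S).egirth ≠ 3) {a : S} (ha : a ∈ nilSet S) (ha0 : a ≠ 0) :
    nilSet S = {0, a} := by
  have : Nontrivial S := ⟨a, 0, ha0⟩
  have hone : ∀ b ∈ nilSet S, b ≠ 1 := by
    rintro b hb rfl
    exact not_isNilpotent_one hb
  refine Set.Subset.antisymm (fun b hb => ?_) ?_
  · by_contra hne
    simp only [Set.mem_insert_iff, Set.mem_singleton_iff, not_or] at hne
    -- The triangle is `a, b, 1`.
    exact hg (nilpotentGraph_egirth_eq_three ha0 hne.1 one_ne_zero (Ne.symm hne.2) (hone a ha)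
      (hone b hb) (h.mul_mem_nilSet ha _) (h.mul_mem_nilSet ha _) (h.mul_mem_nilSet hb _))
  · rintro b (rfl | rfl)
    · exact IsNilpotent.zero
    · exact ha

namespace IsSkewPBWExtension

variable {A : Type*} [Ring A] {R : Subring A} {n : ℕ} {x : Fin n → A}

theorem nilpotentGraph_egirth_eq_three (h : IsSkewPBWExtension R x) (hc : h.Compatible)
    (i : Fin n) {a : R} (ha : a ≠ 0) (haa : a * a = 0) : (nilpotentGraph A).egirth = 3 := by
  have hcoe : (a : A) ≠ 0 := by simpa using ha
  have haa' : (a : A) * (a : A) = 0 := by rw [← Subring.coe_mul, haa, ZeroMemClass.coe_zero]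
  have : Nontrivial A := ⟨a, 0, hcoe⟩
  have hone : (1 : R) ≠ 0 := fun e => ha (by rw [← mul_one a, e, mul_zero])
  -- Adjacency to `1` means nilpotency, and `(a x_i)² = (a x_i a) x_i = 0`.
  refine _root_.nilpotentGraph_egirth_eq_three (a := (a : A)) (b := (a : A) * x i) (c := 1) hcoe
    ?_ one_ne_zero ?_ ?_ ?_ ?_ ?_ ?_
  · exact fun e => ha ((h.coe_eq_mul_x_iff i (a := 0)).1 (by simpa using e.symm)).2
  · exact fun e => ha ((h.coe_eq_mul_x_iff i).1 e).2
  · intro e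
    rw [e, mul_one] at haa'
    exact one_ne_zero haa'
  · exact fun e => hone ((h.coe_eq_mul_x_iff i (a := 1)).1 (by simpa using e.symm)).1
  · rw [← mul_assoc, haa', zero_mul]
    exact IsNilpotent.zero
  · exact ⟨2, by rw [mul_one, pow_two, haa']⟩
  · exact ⟨2, by rw [mul_one, pow_two, ← mul_assoc, hc.mul_x_mul_eq_zero i haa, zero_mul]⟩

theorem nilpotentGraph_egirth_eq_four (h : IsSkewPBWExtension R x) [IsReduced R]
    (hc : h.Compatible) (i : Fin n) (hg : (nilpotentGraph R).egirth ≠ 3)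
    (hne : (nilZeroDivisors R).Nonempty) : (nilpotentGraph A).egirth = 4 := by
  have : IsReduced A := h.isReduced hc.1
  have hdist : ∀ {a b : R}, a ≠ 0 → a * b = 0 → a ≠ b := by
    rintro a b ha hab rfl
    exact ha (IsReduced.eq_zero _ ⟨2, by rwa [pow_two]⟩)
  obtain ⟨a, ha, b, hb, hab⟩ := hne
  rw [mem_nilSet_iff_of_isReduced] at hab
  have hba := mul_eq_zero_symm_of_isReduced hab
  have hcoe : ∀ {c : R}, c ≠ 0 → (c : A) ≠ 0 := fun hc0 => by simpa using hc0
  have hcoex : ∀ {c : R}, c ≠ 0 → (c : A) * x i ≠ 0 := fun hc0 e =>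
    hc0 ((h.coe_eq_mul_x_iff i (a := 0)).1 (by simpa using e.symm)).2
  have hnil : ∀ {f : A}, f = 0 → f ∈ nilSet A := fun hf => mem_nilSet_iff_of_isReduced.2 hf
  have hab' : (a : A) * (b : A) = 0 := by rw [← Subring.coe_mul, hab, ZeroMemClass.coe_zero]
  have hba' : (b : A) * (a : A) = 0 := by rw [← Subring.coe_mul, hba, ZeroMemClass.coe_zero]
  have e1 : (a : A) * (b : A) ∈ nilSet A := hnil hab'
  have e2 : (b : A) * ((a : A) * x i) ∈ nilSet A := hnil (by rw [← mul_assoc, hba', zero_mul])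
  have e3 : (a : A) * x i * ((b : A) * x i) ∈ nilSet A :=
    hnil (by rw [← mul_assoc, hc.mul_x_mul_eq_zero i hab, zero_mul])
  have e4 : (b : A) * x i * (a : A) ∈ nilSet A := hnil (hc.mul_x_mul_eq_zero i hba)
  refine SimpleGraph.egirth_eq_four (G := nilpotentGraph A) ?_
    (a := ⟨a, mem_nilZeroDivisors_of_mul (hcoe ha) (hcoe hb) e1⟩)
    (b := ⟨b, mem_nilZeroDivisors_of_mul (hcoe hb) (hcoex ha) e2⟩)
    (c := ⟨a * x i, mem_nilZeroDivisors_of_mul (hcoex ha) (hcoex hb) e3⟩)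
    (d := ⟨b * x i, mem_nilZeroDivisors_of_mul (hcoex hb) (hcoe ha) e4⟩)
    ⟨?_, e1⟩ ⟨?_, e2⟩ ⟨?_, e3⟩ ⟨?_, e4⟩ ?_ ?_
  · rintro ⟨p, hp, _⟩ ⟨q, hq, _⟩ ⟨r, hr, _⟩ ⟨_, hpq⟩ ⟨_, hpr⟩ ⟨_, hqr⟩
    rw [mem_nilSet_iff_of_isReduced] at hpq hpr hqr
    obtain ⟨α, p₁, hp₁, hp⟩ := h.exists_hasLead hp
    obtain ⟨β, q₁, hq₁, hq⟩ := h.exists_hasLead hq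
    obtain ⟨γ, r₁, hr₁, hr⟩ := h.exists_hasLead hr
    have k1 := hp.mul_eq_zero h hc.1 hq hpq
    have k2 := hp.mul_eq_zero h hc.1 hr hpr
    have k3 := hq.mul_eq_zero h hc.1 hr hqr
    exact hg (_root_.nilpotentGraph_egirth_eq_three hp₁ hq₁ hr₁ (hdist hp₁ k1) (hdist hp₁ k2)
      (hdist hq₁ k3) (mem_nilSet_iff_of_isReduced.2 k1) (mem_nilSet_iff_of_isReduced.2 k2)
      (mem_nilSet_iff_of_isReduced.2 k3))
  · exact fun e => hdist ha hab (Subtype.ext (Subtype.mk.inj e))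
  · exact fun e => hb ((h.coe_eq_mul_x_iff i).1 (congrArg Subtype.val e)).1
  · exact fun e => hdist ha hab (h.mul_x_inj i (congrArg Subtype.val e))
  · exact fun e => ha ((h.coe_eq_mul_x_iff i).1 (congrArg Subtype.val e).symm).1
  · exact fun e => ha ((h.coe_eq_mul_x_iff i).1 (congrArg Subtype.val e)).1
  · exact fun e => hb ((h.coe_eq_mul_x_iff i).1 (congrArg Subtype.val e)).1

end IsSkewPBWExtension

theorem mainTheorem5 {A : Type*} [Ring A] (R : Subring A) {n : ℕ} (hn : 1 ≤ n) (x : Fin n → A)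
    (hA : IsSkewPBWExtension R x) (hcompat : hA.Compatible) (hprimal : IsTwoPrimal R)
    (hgirth : (nilpotentGraph R).egirth = ⊤) (hne : (nilZeroDivisors R).Nonempty) :
    ((nilSet R).ncard = 2 ∧ (nilpotentGraph A).egirth = 3) ∨
      (IsReduced R ∧ (nilpotentGraph A).egirth = 4) := by
  have hg : (nilpotentGraph R).egirth ≠ 3 := by
    rw [hgirth]
    exact ENat.top_ne_ofNat 3
  let i : Fin n := ⟨0, hn⟩
  by_cases hred : IsReduced R
  · exact Or.inr ⟨hred, hA.nilpotentGraph_egirth_eq_four hcompat i hg hne⟩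
  · left
    rw [isReduced_iff_pow_one_lt 2 one_lt_two] at hred
    push Not at hred
    obtain ⟨a, haa, ha⟩ := hred
    refine ⟨?_, hA.nilpotentGraph_egirth_eq_three hcompat i ha (by rwa [← pow_two])⟩
    rw [hprimal.nilSet_eq_pair hg ⟨2, haa⟩ ha, Set.ncard_pair ha.symm]
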